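/- Let $\Sigma$ be a finite alphabet and let $L \subseteq \Sigma^+$ be a language of nonempty words. Then $L$ is definable in $\mathtt{incl}$-$\mathtt{ESO}$-$\mathtt{HORN}$ if and only if its complement $\Sigma^+ \setminus L$ is generated by a linear conjunctive grammar. Here a nonempty word $w = w_1\dots w_n$ is represented by the structure with domain $[1,n]$ (with its usual order), unary predicates $Q_s$ ($s\in\Sigma$) with $Q_s(i) \iff w_i = s$, $\mathtt{min}(i)\iff i=1$, $\mathtt{max}(i)\iff i=n$, and unary functions $\mathtt{suc}(i)=\min(i+1,n)$, $\mathtt{pred}(i)=\max(i-1,1)$; for an integer $k\ge 0$, $x+k$ and $x-k$ denote $\mathtt{suc}^k(x)$ and $\mathtt{pred}^k(x)$. An inclusion Horn formula is a formula $\exists\mathbf R\,\forall x\,\forall y\,\psi(x,y)$ where $\mathbf R$ is a finite set of binary predicates and $\psi$ is a finite conjunction of clauses $x\le y\wedge\delta_1\wedge\dots\wedge\delta_r\to\delta_0$ in which $\delta_0$ is either $R(x,y)$ with $R\in\mathbf R$, or $\bot$, and each $\delta_i$ ($i\ge 1$) is either an input literal $U(x+a)$, $\neg U(x+a)$, $U(y+a)$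 or $\neg U(y+a)$ with $U\in\{(Q_s)_{s\in\Sigma},\mathtt{min},\mathtt{max}\}$ and $a\in\mathbb Z$, or $x=y$, or $x<y$, or a conjunction $S(x+a,y-b)\wedge x+a\le y-b$ with $S\in\mathbf R$ and integers $a,b\ge 0$. Such a formula defines the set of nonempty words whose structure satisfies it; $\mathtt{incl}$-$\mathtt{ESO}$-$\mathtt{HORN}$ is the class of languages so defined. A linear conjunctive grammar $(\Sigma,N,P,S)$ has a finite set $N$ of nonterminals, a start symbol $S\in N$, and a finite set $P$ of rules of the forms $A\to w$ with $A \in N$, $w\in\Sigma^*$, and $A\to u_1B_1v_1\,\&\,\cdots\,\&\,u_mB_mv_m$ with $m\ge 1$, $A,B_i\in N$, $u_i,v_i\in\Sigma^*$. The languages $L(A)\subseteq\Sigma^*$, $A\in N$, are the least solution of the system of equations in which $L(A)$ is the union, over all rules for $A$, of $\{w\}$ for a rule $A\to w$ and of $\bigcap_{i=1}^m u_iL(B_i)v_i$ for a rule $A\to u_1B_1v_1\&\cdots\& u_mB_mv_m$. The grammar generates the language $L(S)$. -/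

import Mathlib

namespace InclHorn

universe u

/-! ### The structure encoding a nonempty word

The domain `[1,n]` of the structure of a word `w` of length `n` is `Fin w.length`, with its usual
order; the position `i ∈ [1,n]` is the element of `Fin w.length` of value `i - 1`. -/

/-- The successor function, with `suc n = n` at the last position. -/
def suc {n : ℕ} (i : Fin n) : Fin n :=
  if h : i.val + 1 < n then ⟨i.val + 1, h⟩ else i

/-- The predecessor function, with `pred 1 = 1` at the first position. -/
def pred {n : ℕ} (i : Fin n) : Fin n :=
  ⟨i.val - 1, lt_of_le_of_lt (Nat.sub_le _ _) i.isLt⟩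

/-- The term `i + a` for `a ∈ ℤ`: `suc` iterated `a` times if `a ≥ 0`, and `pred` iterated
`-a` times if `a < 0`. -/
def shift {n : ℕ} : ℤ → Fin n → Fin n
  | Int.ofNat k, i => suc^[k] i
  | Int.negSucc k, i => pred^[k + 1] i

/-- The input predicates: `Q s` for every letter `s`, `min` and `max`. -/
inductive InputPred (α : Type u) where
  | Q (s : α)
  | min
  | max

/-- Interpretation of the input predicates in the structure of `w`. -/
def InputPred.Holds {α : Type u} (w : List α) : InputPred α → Fin w.length → Prop
  | .Q s, i => w.get i = s
  | .min, i => i.val = 0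
  | .max, i => i.val + 1 = w.length

/-! ### Inclusion Horn formulas -/

/-- The two first-order variables. -/
inductive Var where
  | x
  | y

/-- The value of a variable when `x` and `y` are interpreted by `i` and `j`. -/
def Var.val {n : ℕ} (i j : Fin n) : Var → Fin n
  | .x => i
  | .y => j

/-- The hypotheses `δ` of a clause, over the alphabet `α` and the set `R` of computation
predicates. -/
inductive Hyp (α : Type u) (R : Type) where
  /-- the input literal `U(v + a)` -/
  | pos (U : InputPred α) (v : Var) (a : ℤ)
  /-- the input literal `¬ U(v + a)` -/
  | neg (U : InputPred α) (v : Var) (a : ℤ)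
  /-- `x = y` -/
  | eq
  /-- `x < y` -/
  | lt
  /-- the conjunction `S(x + a, y - b) ∧ x + a ≤ y - b`, with `a, b ≥ 0` -/
  | comp (S : R) (a b : ℕ)

/-- Truth of a hypothesis at `x = i`, `y = j` in the structure of `w` expanded by the
interpretation `I` of the computation predicates. -/
def Hyp.Holds {α : Type u} {R : Type} (w : List α)
    (I : R → Fin w.length → Fin w.length → Prop) (i j : Fin w.length) : Hyp α R → Prop
  | .pos U v a => U.Holds w (shift a (v.val i j))
  | .neg U v a => ¬ U.Holds w (shift a (v.val i j))
  | .eq => i = j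
  | .lt => i < j
  | .comp S a b => I S (shift a i) (shift (-(b : ℤ)) j) ∧ shift (a : ℤ) i ≤ shift (-(b : ℤ)) j

/-- The conclusion of a clause: a computation atom `T(x,y)`, or `⊥`. -/
inductive Concl (R : Type) where
  | comp (T : R)
  | falsum

/-- Truth of a conclusion at `x = i`, `y = j`. -/
def Concl.Holds {R : Type} {n : ℕ} (I : R → Fin n → Fin n → Prop) (i j : Fin n) :
    Concl R → Prop
  | .comp T => I T i j
  | .falsum => False

/-- The clause `x ≤ y ∧ δ₁ ∧ … ∧ δᵣ → δ₀`; the hypothesis `x ≤ y` is always present and is not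
listed in `hyps`. -/
structure Clause (α : Type u) (R : Type) where
  hyps : List (Hyp α R)
  concl : Concl R

/-- Truth of a clause at `x = i`, `y = j`. -/
def Clause.Holds {α : Type u} {R : Type} (w : List α)
    (I : R → Fin w.length → Fin w.length → Prop) (i j : Fin w.length) (c : Clause α R) : Prop :=
  i ≤ j → (∀ δ ∈ c.hyps, δ.Holds w I i j) → c.concl.Holds I i j

/-- An inclusion Horn formula `∃ R ∀ x ∀ y ψ(x,y)`, where `R` is a finite set of binary
computation predicates and `ψ` is a finite conjunction of clauses. -/
structure InclHornFormula (α : Type u) where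
  R : Type
  finite_R : Finite R
  clauses : List (Clause α R)

/-- Satisfaction of an inclusion Horn formula in the structure of the word `w`. -/
def InclHornFormula.Models {α : Type u} (Φ : InclHornFormula α) (w : List α) : Prop :=
  ∃ I : Φ.R → Fin w.length → Fin w.length → Prop,
    ∀ i j : Fin w.length, ∀ c ∈ Φ.clauses, c.Holds w I i j

/-- The language of nonempty words defined by an inclusion Horn formula. -/
def InclHornFormula.language {α : Type u} (Φ : InclHornFormula α) : Set (List α) :=
  {w | w ≠ [] ∧ Φ.Models w}

/-- The class of languages definable in incl-ESO-HORN. -/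
def InclESOHORN {α : Type u} (L : Set (List α)) : Prop :=
  ∃ Φ : InclHornFormula α, Φ.language = L

/-! ### Linear conjunctive grammars -/

/-- A conjunct `u B v`, with `u` and `v` terminal words and `B` a nonterminal. -/
structure Conjunct (α : Type u) (N : Type) where
  u : List α
  B : N
  v : List α

/-- The rules of a linear conjunctive grammar. -/
inductive Rule (α : Type u) (N : Type) where
  /-- the rule `A → w` with `w` a terminal word -/
  | word (A : N) (w : List α)
  /-- the rule `A → u₁B₁v₁ & … & uₘBₘvₘ` with `m ≥ 1` -/
  | conj (A : N) (body : List (Conjunct α N)) (body_ne : body ≠ [])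

/-- A linear conjunctive grammar `(Σ, N, P, S)`, with `N` and `P` finite. -/
structure LinConjGrammar (α : Type u) where
  N : Type
  finite_N : Finite N
  P : Set (Rule α N)
  finite_P : P.Finite
  S : N

/-- `G.Gen A w` means `w ∈ L(A)`: the languages `L(A)` are the least solution of the system
`L(A) = ⋃ (⋂ᵢ uᵢ L(Bᵢ) vᵢ)`, the union being over all rules for `A` (a rule `A → w` contributes
`{w}`). -/
inductive LinConjGrammar.Gen {α : Type u} (G : LinConjGrammar α) : G.N → List α → Prop where
  | word (A : G.N) (w : List α) (h : Rule.word A w ∈ G.P) : G.Gen A w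
  | conj (A : G.N) (body : List (Conjunct α G.N)) (body_ne : body ≠ [])
      (h : Rule.conj A body body_ne ∈ G.P) (w : List α) (z : Conjunct α G.N → List α)
      (hw : ∀ c ∈ body, w = c.u ++ z c ++ c.v) (hz : ∀ c ∈ body, G.Gen c.B (z c)) : G.Gen A w

/-- The language generated by a linear conjunctive grammar. -/
def LinConjGrammar.language {α : Type u} (G : LinConjGrammar α) : Set (List α) :=
  {w | G.Gen G.S w}

/-- The class of languages generated by linear conjunctive grammars. -/
def LinConj {α : Type u} (L : Set (List α)) : Prop :=
  ∃ G : LinConjGrammar α, G.language = L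

/-- The set `Σ⁺` of nonempty words. -/
def sigmaPlus (α : Type u) : Set (List α) := {w | w ≠ []}

end InclHorn

namespace InclHorn

universe u

/-! ### Clamped positions -/

/-! A Horn formula holds in a word exactly when its least model derives no contradiction, so a
formula naturally describes the complement of what its clauses derive; this is why the complement of
`L` appears. The dictionary is that an atom `A(x,y)` speaks of the factor from `x` to `y`, and a
rule for `A` becomes clauses with conclusion `A(x,y)`.

From a grammar, one writes clauses whose least interpretation is "the factor lies in `L(A)`", and
forbids the start symbol on the whole word. Every model contains this interpretation
(`holds_of_gen`), and it is a model if the word is not generated (`grammarModel_holds`). Intervals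
are never empty, so a conjunct `uBv` with `B` nullable also gets the alternative word `uv`.

From a formula, contradiction becomes a predicate that spreads to larger intervals, so that falsity
means deriving it on the whole word (`exists_model_iff_not_der`). A derivation may read letters
outside its interval, but only at distance less than a constant `K`. A nonterminal therefore
describes a factor together with `k, l ≤ K` letters of context; a margin of `K` letters hides the
rest of the word (`Der.append`, `Der.of_append`). In a word of length at least `4K`, the literals of
a clause see only the first and last `2K` letters (`Hyp.lit_middle`), so finitely many rules
suffice; shorter words are listed. `progSem_of_gen` and `gen_of_der` show that this grammar
generates the derivable atoms. -/

/-- The position `t` clamped to the domain `{0, …, n - 1}`. -/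
def clamp (n : ℕ) (t : ℤ) : ℕ := (min t ((n : ℤ) - 1)).toNat

theorem suc_iterate_val {n : ℕ} (k : ℕ) (i : Fin n) :
    (suc^[k] i).val = min (i.val + k) (n - 1) := by
  induction k with
  | zero => simp; omega
  | succ k ih =>
    rw [Function.iterate_succ_apply', suc]
    split_ifs with h
    · simp only; omega
    · omega

theorem pred_iterate_val {n : ℕ} (k : ℕ) (i : Fin n) : (pred^[k] i).val = i.val - k := by
  induction k with
  | zero => simp
  | succ k ih =>
    rw [Function.iterate_succ_apply', pred]
    simp only
    omega

/-- Both saturations, at the first and at the last position, become one arithmetic expression, so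
later position computations are linear arithmetic. -/
theorem shift_val {n : ℕ} (a : ℤ) (i : Fin n) : (shift a i).val = clamp n (i.val + a) := by
  have hi := i.isLt
  cases a with
  | ofNat k => simp only [shift, suc_iterate_val, clamp, Int.ofNat_eq_natCast]; omega
  | negSucc k => simp only [shift, pred_iterate_val, clamp]; omega

/-- An input predicate at the position `t` of `w`. -/
def InputPred.At {α : Type u} (w : List α) : InputPred α → ℕ → Prop
  | .Q s, t => w[t]? = some s
  | .min, t => t = 0
  | .max, t => t + 1 = w.length

theorem InputPred.holds_iff_at {α : Type u} (w : List α) (U : InputPred α) (i : Fin w.length) :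
    U.Holds w i ↔ U.At w i.val := by
  cases U <;> simp [InputPred.Holds, InputPred.At]

/-- The value of a variable when `x` and `y` are interpreted by the positions `i` and `j`. -/
def Var.sel (i j : ℕ) : Var → ℕ
  | .x => i
  | .y => j

theorem Var.val_val {n : ℕ} (i j : Fin n) (v : Var) : (v.val i j).val = v.sel i.val j.val := by
  cases v <;> rfl

theorem holds_shift_iff {α : Type u} (w : List α) (U : InputPred α) (a : ℤ) (v : Var)
    (i j : Fin w.length) : U.Holds w (shift a (v.val i j)) ↔
      U.At w (clamp w.length (v.sel i.val j.val + a)) := by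
  rw [InputPred.holds_iff_at, shift_val, Var.val_val]

/-! ### From grammars to formulas -/

/-- The word `z` occurs in `w` at the position `i`. -/
def Occ {α : Type u} (w : List α) (i : ℕ) (z : List α) : Prop :=
  ∀ t < z.length, w[i + t]? = z[t]?

theorem Occ.append {α : Type u} {w u v : List α} {i : ℕ} :
    Occ w i (u ++ v) ↔ Occ w i u ∧ Occ w (i + u.length) v := by
  constructor
  · intro h
    refine ⟨fun t ht => ?_, fun t ht => ?_⟩
    · have := h t (by simp; omega)
      rwa [List.getElem?_append_left ht] at this
    · have := h (u.length + t) (by simp; omega)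
      rw [List.getElem?_append_right (by omega)] at this
      rw [add_assoc, this]
      congr 1; omega
  · rintro ⟨h1, h2⟩ t ht
    by_cases h : t < u.length
    · rw [List.getElem?_append_left h, h1 t h]
    · rw [List.getElem?_append_right (by omega), ← h2 (t - u.length) (by simp at ht; omega)]
      congr 1; omega

theorem Occ.unique {α : Type u} {w u v : List α} {i : ℕ} (hu : Occ w i u) (hv : Occ w i v)
    (h : u.length = v.length) : u = v := by
  apply List.ext_getElem? 
  intro t
  by_cases ht : t < u.length
  · rw [← hu t ht, ← hv t (h ▸ ht)]
  · rw [List.getElem?_eq_none (by omega), List.getElem?_eq_none (by omega)]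

theorem exists_occ {α : Type u} (w : List α) (i m : ℕ) (h : i + m ≤ w.length) :
    ∃ z : List α, z.length = m ∧ Occ w i z := by
  refine ⟨(w.drop i).take m, by simp; omega, fun t ht => ?_⟩
  simp at ht
  rw [List.getElem?_take_of_lt (by omega), List.getElem?_drop]

theorem occ_self {α : Type u} (w : List α) : Occ w 0 w := fun t _ => by simp

section GrammarToFormula

variable {α : Type u} {N : Type}

/-- The letters of `u` are read from the position `x` on, and none of the first `m` of these
positions is the last one. -/
def prefixHyps (u : List α) (m : ℕ) : List (Hyp α (Option N)) :=
  u.zipIdx.map (fun p => .pos (.Q p.1) .x (p.2 : ℤ)) ++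
    (List.range m).map (fun k => .neg .max .x (k : ℤ))

/-- The letters of `v` are read up to the position `y`, and none of these positions is the first
one. -/
def suffixHyps (v : List α) : List (Hyp α (Option N)) :=
  v.zipIdx.map (fun p => .pos (.Q p.1) .y ((p.2 : ℤ) - v.length + 1)) ++
    (List.range v.length).map (fun k => .neg .min .y (-(k : ℤ)))

theorem forall_mem_zipIdx {β : Type u} (u : List β) (P : β × ℕ → Prop) :
    (∀ p ∈ u.zipIdx, P p) ↔ ∀ t (h : t < u.length), P (u[t], t) := by
  constructor
  · intro h t ht
    exact h _ (by rw [List.mem_zipIdx_iff_getElem?]; simp [ht])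
  · rintro h ⟨b, t⟩ hp
    rw [List.mem_zipIdx_iff_getElem?] at hp
    obtain ⟨ht, hb⟩ := List.getElem?_eq_some_iff.1 hp
    simp only at ht hb
    exact hb ▸ h t ht

/-- If `i + m` overran the word, some `i + k` with `k < m` would be the last position, which the
negative literals exclude. Hence no term saturates. The value `m = u.length` leaves room for a
factor after `u`; `m = u.length - 1` lets `u` end the word. -/
theorem prefixHyps_holds (w u : List α) (m : ℕ) (hm : m ≤ u.length) (hu : u.length ≤ m + 1)
    (I : Option N → Fin w.length → Fin w.length → Prop) (i j : Fin w.length) :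
    (∀ δ ∈ prefixHyps u m, δ.Holds w I i j) ↔ i.val + m < w.length ∧ Occ w i.val u := by
  have hi := i.isLt
  simp only [prefixHyps, List.forall_mem_append, List.forall_mem_map, forall_mem_zipIdx,
    Hyp.Holds, holds_shift_iff, InputPred.At, Var.sel, List.mem_range]
  constructor
  · rintro ⟨h1, h2⟩
    have hlt : i.val + m < w.length := by
      by_contra hc
      -- This is the shift that lands on the last position.
      apply h2 (w.length - 1 - i.val) (by omega)
      simp only [clamp]; omega
    refine ⟨hlt, fun t ht => ?_⟩
    have := h1 t ht
    rw [show clamp w.length (i.val + (t : ℤ)) = i.val + t by simp only [clamp]; omega] at this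
    rw [this]; simp [ht]
  · rintro ⟨hlt, h⟩
    refine ⟨fun t ht => ?_, fun k hk => ?_⟩
    · rw [show clamp w.length (i.val + (t : ℤ)) = i.val + t by simp only [clamp]; omega, h t ht]
      simp [ht]
    · simp only [clamp]; omega

theorem suffixHyps_holds (w v : List α)
    (I : Option N → Fin w.length → Fin w.length → Prop) (i j : Fin w.length) :
    (∀ δ ∈ suffixHyps v, δ.Holds w I i j) ↔
      v.length ≤ j.val ∧ Occ w (j.val + 1 - v.length) v := by
  have hj := j.isLt
  simp only [suffixHyps, List.forall_mem_append, List.forall_mem_map, forall_mem_zipIdx,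
    Hyp.Holds, holds_shift_iff, InputPred.At, Var.sel, List.mem_range]
  constructor
  · rintro ⟨h1, h2⟩
    have hlt : v.length ≤ j.val := by
      by_contra hc
      apply h2 j.val (by omega)
      simp only [clamp]; omega
    refine ⟨hlt, fun t ht => ?_⟩
    have := h1 t ht
    rw [show clamp w.length (j.val + ((t : ℤ) - v.length + 1)) = j.val + 1 - v.length + t by
      simp only [clamp]; omega] at this
    rw [this]; simp [ht]
  · rintro ⟨hlt, h⟩
    refine ⟨fun t ht => ?_, fun k hk => ?_⟩
    · rw [show clamp w.length (j.val + ((t : ℤ) - v.length + 1)) = j.val + 1 - v.length + t by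
        simp only [clamp]; omega, h t ht]
      simp [ht]
    · simp only [clamp]; omega

/-- The factor from `x` to `y` is the nonempty word `w`; the predicate `none` stands for
equality. -/
def wordHyps (w : List α) : List (Hyp α (Option N)) :=
  prefixHyps w (w.length - 1) ++ [.comp none (w.length - 1) 0]

theorem comp_holds {R : Type} (w : List α) (I : R → Fin w.length → Fin w.length → Prop)
    (i j : Fin w.length) (S : R) (a b : ℕ) (ha : i.val + a < w.length) (hb : b ≤ j.val) :
    (Hyp.comp S a b : Hyp α R).Holds w I i j ↔
      I S ⟨i.val + a, ha⟩ ⟨j.val - b, by omega⟩ ∧ i.val + a ≤ j.val - b := by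
  have h1 : shift (a : ℤ) i = ⟨i.val + a, ha⟩ := by
    ext; rw [shift_val]; simp only [clamp]; omega
  have h2 : shift (-(b : ℤ)) j = ⟨j.val - b, by omega⟩ := by
    ext; rw [shift_val]; simp only [clamp]; omega
  simp only [Hyp.Holds, h1, h2, Fin.mk_le_mk]

theorem wordHyps_holds_of_occ (w u : List α) (hu : u ≠ [])
    (I : Option N → Fin w.length → Fin w.length → Prop) (hI : ∀ i, I none i i)
    (i j : Fin w.length) (hij : i.val + u.length = j.val + 1) (h : Occ w i.val u) :
    ∀ δ ∈ wordHyps u, δ.Holds w I i j := by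
  have hl := List.length_pos_iff.2 hu
  have hj := j.isLt
  rw [wordHyps, List.forall_mem_append, prefixHyps_holds _ _ _ (by omega) (by omega)]
  refine ⟨⟨by omega, h⟩, ?_⟩
  simp only [List.mem_singleton, forall_eq]
  rw [comp_holds _ _ _ _ _ _ _ (by omega) (by omega)]
  refine ⟨?_, by omega⟩
  convert hI j using 2
  all_goals omega

/-- Here `none` must be contained in equality, which holds in the least model; the converse
direction only needs it to contain the diagonal, which holds in every model. -/
theorem occ_of_wordHyps_holds (w u : List α) (hu : u ≠ [])
    (I : Option N → Fin w.length → Fin w.length → Prop) (hI : ∀ i j, I none i j → i = j)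
    (i j : Fin w.length) (h : ∀ δ ∈ wordHyps u, δ.Holds w I i j) :
    i.val + u.length = j.val + 1 ∧ Occ w i.val u := by
  have hl := List.length_pos_iff.2 hu
  rw [wordHyps, List.forall_mem_append, prefixHyps_holds _ _ _ (by omega) (by omega)] at h
  obtain ⟨⟨h1, h2⟩, h3⟩ := h
  simp only [List.mem_singleton, forall_eq] at h3
  rw [comp_holds _ _ _ _ _ _ _ h1 (by omega)] at h3
  have := congrArg Fin.val (hI _ _ h3.1)
  simp only at this
  exact ⟨by omega, h2⟩

open Classical in
/-- The hypotheses under which the factor from `x` to `y` is the word `w`. -/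
noncomputable def wordAlts (w : List α) : List (List (Hyp α (Option N))) :=
  if w = [] then [] else [wordHyps w]

/-- The hypotheses under which the factor from `x` to `y` lies in `u L(B) v`, where the factor
in `L(B)` is nonempty. -/
def conjunctHyps (c : Conjunct α N) : List (Hyp α (Option N)) :=
  prefixHyps c.u c.u.length ++ suffixHyps c.v ++ [.comp (some c.B) c.u.length c.v.length]

variable (G : LinConjGrammar α)

open Classical in
/-- The alternative hypotheses under which the factor from `x` to `y` lies in `u L(B) v`. -/
noncomputable def conjunctAlts (c : Conjunct α G.N) : List (List (Hyp α (Option G.N))) :=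
  conjunctHyps c :: if G.Gen c.B [] then wordAlts (c.u ++ c.v) else []

/-- The clauses of a rule. -/
noncomputable def ruleClauses : Rule α G.N → List (Clause α (Option G.N))
  | .word A w => (wordAlts w).map fun h => ⟨h, .comp (some A)⟩
  | .conj A body _ =>
    (body.map (conjunctAlts G)).sections.map fun h => ⟨h.flatten, .comp (some A)⟩

/-- The clauses that define the set of the nonempty words not generated by `G`. -/
noncomputable def grammarClauses : List (Clause α (Option G.N)) :=
  ⟨[.eq], .comp none⟩ ::
    ⟨[.pos .min .x 0, .pos .max .y 0, .comp (some G.S) 0 0], .falsum⟩ ::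
    G.finite_P.toFinset.toList.flatMap (ruleClauses G)

/-- The formula that defines the set of the nonempty words not generated by `G`. -/
noncomputable def grammarFormula : InclHornFormula α where
  R := Option G.N
  finite_R := have := G.finite_N; inferInstance
  clauses := grammarClauses G

variable {G}

/-! ### Correctness of the formula of a grammar -/

theorem LinConjGrammar.Gen.conj_of_exists {A : G.N} {body : List (Conjunct α G.N)}
    {hb : body ≠ []} (h : Rule.conj A body hb ∈ G.P) {w : List α}
    (hw : ∀ c ∈ body, ∃ z, w = c.u ++ z ++ c.v ∧ G.Gen c.B z) : G.Gen A w := by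
  choose! z hz using hw
  exact .conj A body hb h w z (fun c hc => (hz c hc).1) (fun c hc => (hz c hc).2)

/-- Minimality: by induction on the generation, each use of a rule is matched by an instance of one
of its clauses, so any model contains all generated factors. -/
theorem holds_of_gen (w : List α) (I : Option G.N → Fin w.length → Fin w.length → Prop)
    (hI : ∀ i j : Fin w.length, ∀ c ∈ grammarClauses G, c.Holds w I i j)
    {A : G.N} {z : List α} (hA : G.Gen A z) :
    ∀ i j : Fin w.length, i ≤ j → i.val + z.length = j.val + 1 → Occ w i.val z →
      I (some A) i j := by
  have hdiag : ∀ i, I none i i := fun i =>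
    hI i i ⟨[.eq], .comp none⟩ (by simp [grammarClauses]) le_rfl fun δ hδ => by
      rw [List.mem_singleton.1 hδ]; rfl
  have hrule : ∀ r ∈ G.P, ∀ c ∈ ruleClauses G r, ∀ i j, c.Holds w I i j := by
    intro r hr c hc i j
    apply hI i j c
    simp only [grammarClauses, List.mem_cons, List.mem_flatMap, Finset.mem_toList,
      Set.Finite.mem_toFinset]
    exact Or.inr (Or.inr ⟨r, hr, hc⟩)
  induction hA with
  | word A z h =>
    intro i j hij hl hocc
    have hij' : i.val ≤ j.val := hij
    have hz : z ≠ [] := by rintro rfl; simp at hl; omega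
    exact hrule _ h ⟨wordHyps z, .comp (some A)⟩ (by simp [ruleClauses, wordAlts, hz]) i j hij
      (wordHyps_holds_of_occ w z hz I hdiag i j hl hocc)
  | conj A body hb h z zc hw hz ih =>
    intro i j hij hl hocc
    have hij' : i.val ≤ j.val := hij
    have hj := j.isLt
    have hzne : z ≠ [] := by rintro rfl; simp at hl; omega
    have key : ∀ c ∈ body, ∃ l ∈ conjunctAlts G c, ∀ δ ∈ l, δ.Holds w I i j := by
      intro c hc
      have hwc := hw c hc
      -- An empty factor in `L(B)` has no interval to represent it; the alternative for `u ++ v`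
      -- takes over.
      by_cases hzc : zc c = []
      · have hg := hz c hc
        rw [hzc] at hg
        rw [hzc, List.append_nil] at hwc
        refine ⟨wordHyps (c.u ++ c.v), ?_, ?_⟩
        · simp [conjunctAlts, hg, wordAlts, ← hwc, hzne]
        · rw [← hwc]
          exact wordHyps_holds_of_occ w z hzne I hdiag i j hl hocc
      · refine ⟨conjunctHyps c, by simp [conjunctAlts], ?_⟩
        have hpos := List.length_pos_iff.2 hzc
        have hlen := congrArg List.length hwc
        simp only [List.length_append] at hlen
        have ho := hocc
        rw [hwc, Occ.append, Occ.append] at ho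
        obtain ⟨⟨ho1, ho2⟩, ho3⟩ := ho
        rw [conjunctHyps, List.forall_mem_append, List.forall_mem_append,
          prefixHyps_holds _ _ _ le_rfl (by omega), suffixHyps_holds]
        refine ⟨⟨⟨by omega, ho1⟩, by omega, ?_⟩, ?_⟩
        · convert ho3 using 1
          simp only [List.length_append]; omega
        · simp only [List.mem_singleton, forall_eq]
          rw [comp_holds _ _ _ _ _ _ _ (by omega) (by omega)]
          refine ⟨ih c hc _ _ ?_ ?_ ho2, by omega⟩
          · simp only [Fin.mk_le_mk]; omega
          · simp only; omega
    choose! f hf using key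
    refine hrule _ h ⟨(body.map f).flatten, .comp (some A)⟩ ?_ i j hij ?_
    -- The clauses of a rule range over all choices of one alternative per conjunct; `f` is such a
    -- choice.
    · simp only [ruleClauses, List.mem_map]
      refine ⟨body.map f, ?_, rfl⟩
      rw [List.mem_sections, List.forall₂_map_left_iff, List.forall₂_map_right_iff,
        List.forall₂_same]
      exact fun c hc => (hf c hc).1
    · intro δ hδ
      simp only [List.mem_flatten, List.mem_map] at hδ
      obtain ⟨l, ⟨c, hc, rfl⟩, hδ⟩ := hδ
      exact (hf c hc).2 δ hδ

variable (G) in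
/-- The least model of the clauses of `grammarClauses G` other than the last one. -/
def grammarModel (w : List α) : Option G.N → Fin w.length → Fin w.length → Prop
  | none, i, j => i = j
  | some A, i, j => ∃ z, i.val + z.length = j.val + 1 ∧ Occ w i.val z ∧ G.Gen A z

theorem wordAlts_spec {w u : List α} {i j : Fin w.length} {l : List (Hyp α (Option G.N))}
    (hl : l ∈ wordAlts u) (h : ∀ δ ∈ l, δ.Holds w (grammarModel G w) i j) :
    i.val + u.length = j.val + 1 ∧ Occ w i.val u := by
  rw [wordAlts] at hl
  split_ifs at hl with hu
  · simp at hl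
  · rw [List.mem_singleton] at hl
    subst hl
    exact occ_of_wordHyps_holds w u hu _ (fun _ _ h => h) i j h

theorem conjunctAlts_spec {w : List α} {i j : Fin w.length} {c : Conjunct α G.N}
    {l : List (Hyp α (Option G.N))}
    (hl : l ∈ conjunctAlts G c) (h : ∀ δ ∈ l, δ.Holds w (grammarModel G w) i j) :
    ∃ z, i.val + (c.u ++ z ++ c.v).length = j.val + 1 ∧ Occ w i.val (c.u ++ z ++ c.v) ∧
      G.Gen c.B z := by
  rw [conjunctAlts, List.mem_cons] at hl
  rcases hl with rfl | hl
  · rw [conjunctHyps, List.forall_mem_append, List.forall_mem_append,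
      prefixHyps_holds _ _ _ le_rfl (by omega), suffixHyps_holds] at h
    obtain ⟨⟨⟨h1, h2⟩, h3, h4⟩, h5⟩ := h
    simp only [List.mem_singleton, forall_eq] at h5
    rw [comp_holds _ _ _ _ _ _ _ h1 h3] at h5
    obtain ⟨⟨z, hz1, hz2, hz3⟩, hle⟩ := h5
    simp only at hz1 hz2
    refine ⟨z, by simp only [List.length_append]; omega, ?_, hz3⟩
    rw [Occ.append, Occ.append]
    refine ⟨⟨h2, hz2⟩, ?_⟩
    convert h4 using 1
    simp only [List.length_append]; omega
  · split_ifs at hl with hg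
    · have := wordAlts_spec hl h
      exact ⟨[], by simpa using this.1, by simpa using this.2, hg⟩
    · simp at hl

/-- The clauses of a rule hold because the languages `L(A)` are closed under that rule; the clause
for `⊥` holds because an occurrence at position `0` of a word as long as `w` is `w` itself. -/
theorem grammarModel_holds {w : List α} (hw : ¬ G.Gen G.S w) (i j : Fin w.length)
    (c : Clause α (Option G.N)) (hc : c ∈ grammarClauses G) :
    c.Holds w (grammarModel G w) i j := by
  simp only [grammarClauses, List.mem_cons, List.mem_flatMap, Finset.mem_toList,
    Set.Finite.mem_toFinset] at hc
  have hi := i.isLt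
  have hj := j.isLt
  rcases hc with rfl | rfl | ⟨r, hr, hc⟩
  · intro _ h
    exact h .eq (by simp)
  · intro hij h
    simp only [List.forall_mem_cons, Hyp.Holds, holds_shift_iff, InputPred.At, Var.sel] at h
    obtain ⟨h1, h2, ⟨⟨z, hz1, hz2, hz3⟩, -⟩, -⟩ := h
    have e1 : i.val = 0 := by simp only [clamp] at h1; omega
    have e2 : j.val + 1 = w.length := by simp only [clamp] at h2; omega
    simp only [shift_val] at hz1 hz2
    have e3 : clamp w.length (i.val + ((0 : ℕ) : ℤ)) = 0 := by simp only [clamp]; omega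
    have e4 : clamp w.length (j.val + -((0 : ℕ) : ℤ)) = j.val := by simp only [clamp]; omega
    rw [e3] at hz2
    rw [e3, e4] at hz1
    have := hz2.unique (occ_self w) (by omega)
    exact hw (this ▸ hz3)
  · cases r with
    | word A u =>
      simp only [ruleClauses, List.mem_map] at hc
      obtain ⟨l, hl, rfl⟩ := hc
      intro _ h
      have := wordAlts_spec hl h
      exact ⟨u, this.1, this.2, .word A u hr⟩
    | conj A body hb =>
      simp only [ruleClauses, List.mem_map] at hc
      obtain ⟨ls, hls, rfl⟩ := hc
      intro hij h
      rw [List.mem_sections, List.forall₂_map_right_iff] at hls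
      have hij' : i.val ≤ j.val := hij
      -- All conjuncts must decompose the same word: it is the factor from `i` to `j`, and each
      -- decomposition is identified with it by `Occ.unique`.
      obtain ⟨z, hz, hocc⟩ := exists_occ w i.val (j.val + 1 - i.val) (by omega)
      refine ⟨z, by omega, hocc, .conj_of_exists hr fun c hc => ?_⟩
      have : ∃ l ∈ ls, l ∈ conjunctAlts G c := by
        clear h hr hb
        induction hls with
        | nil => simp at hc
        | cons h1 _ ih =>
          rcases List.mem_cons.1 hc with rfl | hc
          · exact ⟨_, List.mem_cons_self, h1⟩
          · obtain ⟨l, hl, hl'⟩ := ih hc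
            exact ⟨l, List.mem_cons_of_mem _ hl, hl'⟩
      obtain ⟨l, hl, hl'⟩ := this
      obtain ⟨z', h1, h2, h3⟩ := conjunctAlts_spec hl'
        (fun δ hδ => h δ (List.mem_flatten.2 ⟨l, hl, hδ⟩))
      exact ⟨z', hocc.unique h2 (by omega), h3⟩

theorem exists_model_grammarClauses_iff {w : List α} (hw : w ≠ []) :
    (∃ I : Option G.N → Fin w.length → Fin w.length → Prop,
      ∀ i j : Fin w.length, ∀ c ∈ grammarClauses G, c.Holds w I i j) ↔ ¬ G.Gen G.S w := by
  have hl := List.length_pos_iff.2 hw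
  constructor
  · rintro ⟨I, hI⟩ hg
    let i : Fin w.length := ⟨0, hl⟩
    let j : Fin w.length := ⟨w.length - 1, by omega⟩
    have hij : i ≤ j := Fin.mk_le_mk.2 (Nat.zero_le _)
    have h := holds_of_gen w I hI hg i j hij (by simp only [i, j]; omega) (occ_self w)
    refine hI i j ⟨[.pos .min .x 0, .pos .max .y 0, .comp (some G.S) 0 0], .falsum⟩
      (by simp [grammarClauses]) hij ?_
    simp only [List.forall_mem_cons, Hyp.Holds, holds_shift_iff, InputPred.At, Var.sel]
    refine ⟨by simp only [clamp, i]; omega, by simp only [clamp, j]; omega, ?_, by simp⟩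
    exact ⟨h, hij⟩
  · exact fun h => ⟨grammarModel G w, fun i j c hc => grammarModel_holds h i j c hc⟩

theorem grammarFormula_models_iff {w : List α} (hw : w ≠ []) :
    (grammarFormula G).Models w ↔ ¬ G.Gen G.S w :=
  exists_model_grammarClauses_iff hw

end GrammarToFormula

theorem inclESOHORN_of_linConj {α : Type u} {L : Set (List α)} (hL : L ⊆ sigmaPlus α)
    (h : LinConj (sigmaPlus α \ L)) : InclESOHORN L := by
  obtain ⟨G, hG⟩ := h
  refine ⟨grammarFormula G, ?_⟩
  ext w
  have hw : G.Gen G.S w ↔ w ≠ [] ∧ w ∉ L := Set.ext_iff.1 hG w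
  constructor
  · rintro ⟨h1, h2⟩
    rw [grammarFormula_models_iff h1, hw] at h2
    by_contra h
    exact h2 ⟨h1, h⟩
  · intro h
    have h1 : w ≠ [] := hL h
    refine ⟨h1, ?_⟩
    rw [grammarFormula_models_iff h1, hw]
    exact fun h2 => h2.2 h

/-! ### From formulas to grammars -/

section FormulaToGrammar

variable {α : Type u} {R : Type}

/-! ### Least models of Horn clauses -/

/-- Truth at the positions `i` and `j` of the part of a hypothesis that does not depend on the
computation predicates. -/
def Hyp.Lit (w : List α) (i j : ℕ) : Hyp α R → Prop
  | .pos U v a => U.At w (clamp w.length (v.sel i j + a))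
  | .neg U v a => ¬ U.At w (clamp w.length (v.sel i j + a))
  | .eq => i = j
  | .lt => i < j
  | .comp _ a b => clamp w.length (i + (a : ℤ)) ≤ clamp w.length (j - (b : ℤ))

/-- Renaming of the computation predicates. -/
def Hyp.map {R' : Type} (f : R → R') : Hyp α R → Hyp α R'
  | .pos U v a => .pos U v a
  | .neg U v a => .neg U v a
  | .eq => .eq
  | .lt => .lt
  | .comp S a b => .comp (f S) a b

theorem Hyp.lit_map {R' : Type} (f : R → R') (w : List α) (i j : ℕ) (δ : Hyp α R) :
    (δ.map f).Lit w i j ↔ δ.Lit w i j := by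
  cases δ <;> rfl

/-- The computation atoms derivable from the clauses of `P` in the structure of `w`. -/
inductive Der (P : List (List (Hyp α R) × R)) (w : List α) : R → ℕ → ℕ → Prop
  | intro (c : List (Hyp α R) × R) (hc : c ∈ P) (i j : ℕ) (hij : i ≤ j) (hj : j < w.length)
      (lit : ∀ δ ∈ c.1, δ.Lit w i j)
      (sub : ∀ T a b, Hyp.comp T a b ∈ c.1 →
        Der P w T (clamp w.length (i + (a : ℤ))) (clamp w.length (j - (b : ℤ)))) :
      Der P w c.2 i j

/-- The predicate of a conclusion, where `⊥` is represented by `none`. -/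
def Concl.pred : Concl R → Option R
  | .comp T => some T
  | .falsum => none

/-- The clauses of a formula, with `⊥` turned into a predicate that is propagated to the larger
intervals. -/
def programOf (C : List (Clause α R)) : List (List (Hyp α (Option R)) × Option R) :=
  ([.comp none 1 0], none) :: ([.comp none 0 1], none) ::
    C.map fun c => (c.hyps.map (Hyp.map some), c.concl.pred)

/-- A contradiction may arise on any interval, but the start symbol only inspects the whole word.
The two propagation clauses widen the interval one position at a time, to the right and then to the
left. -/
theorem der_none_of_le {C : List (Clause α R)} {w : List α} {i j : ℕ} (hij : i ≤ j)
    (h : Der (programOf C) w none i j) {i' j' : ℕ} (hi : i' ≤ i) (hj : j ≤ j')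
    (hj' : j' < w.length) : Der (programOf C) w none i' j' := by
  have right : ∀ k, j + k < w.length → Der (programOf C) w none i (j + k) := by
    intro k
    induction k with
    | zero => exact fun _ => h
    | succ k ih =>
      intro hk
      have e1 : clamp w.length (i + ((0 : ℕ) : ℤ)) = i := by simp only [clamp]; omega
      have e2 : clamp w.length (((j + (k + 1) : ℕ) : ℤ) - ((1 : ℕ) : ℤ)) = j + k := by
        simp only [clamp]; omega
      refine .intro ([.comp none 0 1], none) (by simp [programOf]) _ _ (by omega) hk ?_ ?_
      · simp only [List.mem_singleton, forall_eq, Hyp.Lit, e1, e2]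
        omega
      · intro T a b hT
        simp only [List.mem_singleton, Hyp.comp.injEq] at hT
        obtain ⟨rfl, rfl, rfl⟩ := hT
        rw [e1, e2]
        exact ih (by omega)
  have left : ∀ k ≤ i, Der (programOf C) w none (i - k) j' := by
    intro k
    induction k with
    | zero =>
      intro _
      have := right (j' - j) (by omega)
      rwa [Nat.add_sub_cancel' hj] at this
    | succ k ih =>
      intro hk
      have e1 : clamp w.length (((i - (k + 1) : ℕ) : ℤ) + ((1 : ℕ) : ℤ)) = i - k := by
        simp only [clamp]; omega
      have e2 : clamp w.length ((j' : ℤ) - ((0 : ℕ) : ℤ)) = j' := by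
        simp only [clamp]; omega
      refine .intro ([.comp none 1 0], none) (by simp [programOf]) _ _ (by omega) hj' ?_ ?_
      · simp only [List.mem_singleton, forall_eq, Hyp.Lit, e1, e2]
        omega
      · intro T a b hT
        simp only [List.mem_singleton, Hyp.comp.injEq] at hT
        obtain ⟨rfl, rfl, rfl⟩ := hT
        rw [e1, e2]
        exact ih (by omega)
  have := left (i - i') (by omega)
  rwa [Nat.sub_sub_self hi] at this

theorem Hyp.holds_iff (w : List α) (I : R → Fin w.length → Fin w.length → Prop)
    (i j : Fin w.length) (δ : Hyp α R) : δ.Holds w I i j ↔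
      δ.Lit w i.val j.val ∧
        ∀ T a b, δ = .comp T a b → I T (shift (a : ℤ) i) (shift (-(b : ℤ)) j) := by
  cases δ with
  | pos U v a => simp [Hyp.Holds, Hyp.Lit, holds_shift_iff]
  | neg U v a => simp [Hyp.Holds, Hyp.Lit, holds_shift_iff]
  | eq => simp [Hyp.Holds, Hyp.Lit, Fin.ext_iff]
  | lt => simp [Hyp.Holds, Hyp.Lit]
  | comp S a b =>
    have : shift (a : ℤ) i ≤ shift (-(b : ℤ)) j ↔
        clamp w.length (i.val + (a : ℤ)) ≤ clamp w.length (j.val - (b : ℤ)) := by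
      rw [Fin.le_def, shift_val, shift_val, sub_eq_add_neg]
    simp only [Hyp.Holds, Hyp.Lit, this, Hyp.comp.injEq]
    constructor
    · rintro ⟨h1, h2⟩
      refine ⟨h2, ?_⟩
      rintro T a' b' ⟨rfl, rfl, rfl⟩
      exact h1
    · rintro ⟨h1, h2⟩
      exact ⟨h2 S a b ⟨rfl, rfl, rfl⟩, h1⟩

/-- A model contains every derivable atom. In particular `none` is never derived: a clause with
conclusion `⊥` would be violated, and propagation needs an earlier `none`. -/
theorem not_der_of_model {C : List (Clause α R)} {w : List α}
    (I : R → Fin w.length → Fin w.length → Prop)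
    (hI : ∀ i j : Fin w.length, ∀ c ∈ C, c.Holds w I i j) {S : Option R} {i j : ℕ}
    (h : Der (programOf C) w S i j) :
    ∃ T, S = some T ∧ ∀ (hi : i < w.length) (hj : j < w.length), I T ⟨i, hi⟩ ⟨j, hj⟩ := by
  induction h with
  | intro c hc i j hij hj lit sub ih =>
    simp only [programOf, List.mem_cons, List.mem_map] at hc
    rcases hc with rfl | rfl | ⟨c, hc, rfl⟩
    · obtain ⟨T, hT, -⟩ := ih none 1 0 (by simp)
      simp at hT
    · obtain ⟨T, hT, -⟩ := ih none 0 1 (by simp)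
      simp at hT
    · have key : c.concl.Holds I ⟨i, by omega⟩ ⟨j, hj⟩ := by
        refine hI ⟨i, by omega⟩ ⟨j, hj⟩ c hc hij fun δ hδ => ?_
        have hδ' := List.mem_map_of_mem (f := Hyp.map some) hδ
        rw [Hyp.holds_iff]
        refine ⟨(Hyp.lit_map some w i j δ).1 (lit _ hδ'), ?_⟩
        rintro T a b rfl
        obtain ⟨T', hT', h⟩ := ih (some T) a b hδ'
        obtain rfl := Option.some.inj hT'
        have e1 := shift_val (a : ℤ) (⟨i, by omega⟩ : Fin w.length)
        have e2 := shift_val (-(b : ℤ)) (⟨j, hj⟩ : Fin w.length)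
        rw [← sub_eq_add_neg] at e2
        convert h (e1 ▸ Fin.isLt _) (e2 ▸ Fin.isLt _) using 1
        · exact Fin.ext e1
        · exact Fin.ext e2
      revert key
      cases c.concl with
      | comp T => exact fun key => ⟨T, rfl, fun _ _ => key⟩
      | falsum => exact fun key => key.elim

theorem exists_model_iff_not_der (C : List (Clause α R)) {w : List α} (hw : w ≠ []) :
    (∃ I : R → Fin w.length → Fin w.length → Prop,
      ∀ i j : Fin w.length, ∀ c ∈ C, c.Holds w I i j) ↔
      ¬ Der (programOf C) w none 0 (w.length - 1) := by
  have hl := List.length_pos_iff.2 hw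
  constructor
  · rintro ⟨I, hI⟩ h
    obtain ⟨T, hT, -⟩ := not_der_of_model I hI h
    simp at hT
  · intro h
    -- The derivable atoms form the least model of the clauses with a computation atom as
    -- conclusion.
    refine ⟨fun T i j => Der (programOf C) w (some T) i j, fun i j c hc hij hyps => ?_⟩
    have key : Der (programOf C) w c.concl.pred i j := by
      refine .intro (c.hyps.map (Hyp.map some), c.concl.pred) ?_ i j hij j.isLt ?_ ?_
      · simp only [programOf, List.mem_cons, List.mem_map]
        exact Or.inr (Or.inr ⟨c, hc, rfl⟩)
      · simp only [List.forall_mem_map, Hyp.lit_map]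
        exact fun δ hδ => ((Hyp.holds_iff _ _ _ _ _).1 (hyps δ hδ)).1
      · intro T a b hT
        obtain ⟨δ, hδ, e⟩ := List.mem_map.1 hT
        cases δ with
        | comp S a' b' =>
          simp only [Hyp.map, Hyp.comp.injEq] at e
          obtain ⟨rfl, rfl, rfl⟩ := e
          have := ((Hyp.holds_iff _ _ _ _ _).1 (hyps _ hδ)).2 S a' b' rfl
          rwa [shift_val, shift_val, ← sub_eq_add_neg] at this
        | _ => simp [Hyp.map] at e
    revert key
    cases c.concl with
    | comp T => exact id
    | falsum =>
      exact fun key => (h (der_none_of_le hij key (Nat.zero_le _) (by omega) (by omega))).elim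

/-! #### Locality -/

/-- A bound on the shifts in a hypothesis. -/
def Hyp.size : Hyp α R → ℕ
  | .pos _ _ a => a.natAbs
  | .neg _ _ a => a.natAbs
  | .eq => 0
  | .lt => 0
  | .comp _ a b => a + b

theorem exists_size_lt (P : List (List (Hyp α R) × R)) :
    ∃ K, 0 < K ∧ ∀ c ∈ P, ∀ δ ∈ c.1, δ.size < K := by
  refine ⟨((P.flatMap Prod.fst).map Hyp.size).sum + 1, by omega, fun c hc δ hδ => ?_⟩
  have : δ.size ∈ (P.flatMap Prod.fst).map Hyp.size :=
    List.mem_map_of_mem (List.mem_flatMap.2 ⟨c, hc, hδ⟩)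
  have := List.le_sum_of_mem this
  omega

theorem InputPred.at_append (U : InputPred α) (c z d : List α) {t : ℕ} (ht : t < z.length)
    (hc : c = [] ∨ 0 < t) (hd : d = [] ∨ t + 1 < z.length) :
    U.At (c ++ z ++ d) (c.length + t) ↔ U.At z t := by
  cases U with
  | Q s =>
    simp only [InputPred.At]
    rw [List.getElem?_append_left (by simp; omega), List.getElem?_append_right (by omega)]
    simp
  | min =>
    simp only [InputPred.At]
    rcases hc with rfl | hc
    · simp
    · omega
  | max =>
    simp only [InputPred.At, List.length_append]
    rcases hd with rfl | hd
    · simp; omega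
    · omega

theorem clamp_append (c z d : List α) {t : ℤ} (hz : 0 < z.length) (hc : c = [] ∨ 0 ≤ t)
    (hd : d = [] ∨ t + 1 ≤ z.length) :
    clamp (c ++ z ++ d).length (c.length + t) = c.length + clamp z.length t := by
  have hc' : c.length = 0 ∨ 0 ≤ t := hc.imp_left fun h => by rw [h, List.length_nil]
  have hd' : d.length = 0 ∨ t + 1 ≤ z.length := hd.imp_left fun h => by rw [h, List.length_nil]
  simp only [clamp, List.length_append]
  omega

theorem Var.sel_add (m i j : ℕ) (v : Var) : v.sel (m + i) (m + j) = m + v.sel i j := by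
  cases v <;> rfl

/-- Shifts are strictly smaller than `K`, so with a margin of `K` a term stays off the border
positions of `z`. Neither saturation nor `min` and `max` can then detect that `c` or `d` was
attached. On a side where nothing is attached, no margin is needed. -/
theorem Hyp.lit_append {δ : Hyp α R} {K : ℕ} (hδ : δ.size < K) (c z d : List α) {i j : ℕ}
    (hij : i ≤ j) (hj : j < z.length) (hc : c = [] ∨ K ≤ i) (hd : d = [] ∨ j + K < z.length) :
    δ.Lit (c ++ z ++ d) (c.length + i) (c.length + j) ↔ δ.Lit z i j := by
  have input : ∀ (U : InputPred α) (v : Var) (a : ℤ), a.natAbs < K →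
      (U.At (c ++ z ++ d) (clamp (c ++ z ++ d).length
        ((v.sel (c.length + i) (c.length + j) : ℕ) + a)) ↔
        U.At z (clamp z.length (v.sel i j + a))) := by
    intro U v a ha
    have h1 : i ≤ v.sel i j := by cases v <;> simp [Var.sel, hij]
    have h2 : v.sel i j ≤ j := by cases v <;> simp [Var.sel, hij]
    rw [Var.sel_add, Nat.cast_add, add_assoc, clamp_append c z d (by omega)
      (hc.imp_right fun _ => by omega) (hd.imp_right fun _ => by omega)]
    apply InputPred.at_append
    · simp only [clamp]; omega
    · exact hc.imp_right fun _ => by simp only [clamp]; omega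
    · exact hd.imp_right fun _ => by simp only [clamp]; omega
  cases δ with
  | pos U v a => exact input U v a hδ
  | neg U v a => exact not_congr (input U v a hδ)
  | eq => simp [Hyp.Lit]
  | lt => simp [Hyp.Lit]
  | comp S a b =>
    simp only [Hyp.size] at hδ
    simp only [Hyp.Lit]
    rw [Nat.cast_add, add_assoc, Nat.cast_add, add_sub_assoc,
      clamp_append c z d (by omega) (hc.imp_right fun _ => by omega)
        (hd.imp_right fun _ => by omega),
      clamp_append c z d (by omega) (hc.imp_right fun _ => by omega)
        (hd.imp_right fun _ => by omega)]
    omega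

theorem clamp_append_comp {K a b : ℕ} (hδ : a + b < K) (c z d : List α) {i j : ℕ}
    (hij : i ≤ j) (hj : j < z.length) (hc : c = [] ∨ K ≤ i) (hd : d = [] ∨ j + K < z.length) :
    clamp (c ++ z ++ d).length (((c.length + i : ℕ) : ℤ) + a) =
        c.length + clamp z.length (i + (a : ℤ)) ∧
      clamp (c ++ z ++ d).length (((c.length + j : ℕ) : ℤ) - b) =
        c.length + clamp z.length (j - (b : ℤ)) := by
  rw [Nat.cast_add, add_assoc, Nat.cast_add, add_sub_assoc,
    clamp_append c z d (by omega) (hc.imp_right fun _ => by omega)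
      (hd.imp_right fun _ => by omega),
    clamp_append c z d (by omega) (hc.imp_right fun _ => by omega)
      (hd.imp_right fun _ => by omega)]
  exact ⟨rfl, rfl⟩

variable {P : List (List (Hyp α R) × R)} {K : ℕ}

/-- Computation hypotheses only move `x` to the right and `y` to the left, so a margin of `K`
persists through the whole derivation. -/
theorem Der.append (hP : ∀ c ∈ P, ∀ δ ∈ c.1, δ.size < K) (c d : List α) {z : List α} {S : R}
    {i j : ℕ} (h : Der P z S i j) (hc : c = [] ∨ K ≤ i) (hd : d = [] ∨ j + K < z.length) :
    Der P (c ++ z ++ d) S (c.length + i) (c.length + j) := by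
  induction h with
  | intro r hr i j hij hj lit sub ih =>
    refine .intro r hr _ _ (by omega) (by simp only [List.length_append]; omega) ?_ ?_
    · exact fun δ hδ => (Hyp.lit_append (hP r hr δ hδ) c z d hij hj hc hd).2 (lit δ hδ)
    · intro T a b hT
      have hab : a + b < K := hP r hr _ hT
      obtain ⟨e1, e2⟩ := clamp_append_comp hab c z d hij hj hc hd
      rw [e1, e2]
      apply ih T a b hT
      · exact hc.imp_right fun _ => by simp only [clamp]; omega
      · exact hd.imp_right fun _ => by simp only [clamp]; omega

theorem Der.of_append (hP : ∀ c ∈ P, ∀ δ ∈ c.1, δ.size < K) {c d z w : List α}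
    {S : R} {i' j' : ℕ} (h : Der P w S i' j') (hw : w = c ++ z ++ d) :
    ∀ i j, i' = c.length + i → j' = c.length + j → j < z.length →
      (c = [] ∨ K ≤ i) → (d = [] ∨ j + K < z.length) → Der P z S i j := by
  subst hw
  induction h with
  | intro r hr i' j' hij hj' lit sub ih =>
    rintro i j rfl rfl hj hc hd
    have hij : i ≤ j := by omega
    refine .intro r hr _ _ hij hj ?_ ?_
    · exact fun δ hδ => (Hyp.lit_append (hP r hr δ hδ) c z d hij hj hc hd).1 (lit δ hδ)
    · intro T a b hT
      have hab : a + b < K := hP r hr _ hT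
      obtain ⟨e1, e2⟩ := clamp_append_comp hab c z d hij hj hc hd
      apply ih T a b hT _ _ e1 e2
      · simp only [clamp]; omega
      · exact hc.imp_right fun _ => by simp only [clamp]; omega
      · exact hd.imp_right fun _ => by simp only [clamp]; omega

theorem InputPred.at_middle_left (U : InputPred α) {p q : List α} (m m' : List α) {t : ℕ}
    (ht : t < p.length) (hq : 0 < q.length) :
    U.At (p ++ m ++ q) t → U.At (p ++ m' ++ q) t := by
  cases U with
  | Q s =>
    simp only [InputPred.At]
    rw [List.append_assoc, List.append_assoc, List.getElem?_append_left ht,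
      List.getElem?_append_left ht]
    exact id
  | min => exact id
  | max => simp only [InputPred.At, List.length_append]; omega

theorem InputPred.at_middle_right (U : InputPred α) {p q : List α} (m m' : List α) {s t t' : ℕ}
    (hp : 0 < p.length) (ht : t = p.length + m.length + s)
    (ht' : t' = p.length + m'.length + s) :
    U.At (p ++ m ++ q) t → U.At (p ++ m' ++ q) t' := by
  subst ht ht'
  cases U with
  | Q s =>
    simp only [InputPred.At]
    rw [List.getElem?_append_right (by simp), List.getElem?_append_right (by simp)]
    simp
  | min => simp only [InputPred.At]; omega
  | max => simp only [InputPred.At, List.length_append]; omega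

/-- With `k, l ≤ K` and shifts below `K`, terms in `x` stay in `p` and terms in `y` stay in `q`. The
positions are so far apart that `x = y` fails and the inequalities hold, whatever the middle is. -/
theorem Hyp.lit_middle {δ : Hyp α R} (hδ : δ.size < K) {p q : List α}
    (hp : p.length = 2 * K) (hq : q.length = 2 * K) (m m' : List α) {k l : ℕ} (hk : k ≤ K)
    (hl : l ≤ K) (h : δ.Lit (p ++ m ++ q) k ((p ++ m ++ q).length - 1 - l)) :
    δ.Lit (p ++ m' ++ q) k ((p ++ m' ++ q).length - 1 - l) := by
  have input : ∀ (U : InputPred α) (v : Var) (a : ℤ), a.natAbs < K → ∀ m m' : List α,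
      U.At (p ++ m ++ q) (clamp (p ++ m ++ q).length
        ((v.sel k ((p ++ m ++ q).length - 1 - l) : ℕ) + a)) →
      U.At (p ++ m' ++ q) (clamp (p ++ m' ++ q).length
        ((v.sel k ((p ++ m' ++ q).length - 1 - l) : ℕ) + a)) := by
    intro U v a ha m m'
    cases v with
    | x =>
      have e : ∀ m : List α, clamp (p ++ m ++ q).length ((k : ℤ) + a) = (k + a).toNat := by
        intro m
        simp only [clamp, List.length_append]; omega
      simp only [Var.sel, e]
      exact InputPred.at_middle_left U m m' (by omega) (by omega)
    | y =>
      simp only [Var.sel]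
      -- `s` is the index within `q` of the clamped `y + a`; `(l - a).toNat` counts the letters
      -- after it, saturating at the end of the word.
      apply InputPred.at_middle_right U m m' (s := 2 * K - 1 - (l - a).toNat) (by omega)
      · simp only [clamp, List.length_append]; omega
      · simp only [clamp, List.length_append]; omega
  cases δ with
  | pos U v a => exact input U v a hδ m m' h
  | neg U v a => exact fun h' => h (input U v a hδ m' m h')
  | eq => simp only [Hyp.Lit, List.length_append] at h ⊢; omega
  | lt => simp only [Hyp.Lit, List.length_append] at h ⊢; omega
  | comp S a b =>
    simp only [Hyp.size] at hδ
    simp only [Hyp.Lit, List.length_append, clamp] at h ⊢; omega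

/-! #### The grammar -/

/-- The nonterminals: `none` generates all words; `some (S, k, l)` generates the words `z` such
that `S` is derivable in `z` for the factor obtained by removing the first `k` and the last `l`
letters. -/
abbrev ProgNonterminal (R : Type) (K : ℕ) : Type := Option (R × Fin (K + 1) × Fin (K + 1))

/-- The words that a nonterminal is meant to generate. -/
def ProgSem (P : List (List (Hyp α R) × R)) (K : ℕ) : ProgNonterminal R K → List α → Prop
  | none, _ => True
  | some (S, k, l), z => k.val + l.val < z.length ∧ Der P z S k.val (z.length - 1 - l.val)

/-- The conjunct that corresponds to the hypothesis `T(x + a, y - b)`. -/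
def hypConjunct (p q : List α) (k l : Fin (K + 1)) : Hyp α R → Option (Conjunct α
    (ProgNonterminal R K))
  | .comp T a b => some ⟨p.take (k.val + a - K),
      some (T, ⟨min (k.val + a) K, by omega⟩, ⟨min (l.val + b) K, by omega⟩),
      q.drop (2 * K - (l.val + b - K))⟩
  | _ => none

/-- The rule for a clause and a word with prefix `p` and suffix `q`. -/
def clauseRule (c : List (Hyp α R) × R) (p q : List α) (k l : Fin (K + 1)) :
    Rule α (ProgNonterminal R K) :=
  .conj (some (c.2, k, l)) (⟨p, none, q⟩ :: c.1.filterMap (hypConjunct p q k l))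
    (List.cons_ne_nil _ _)

/-- The rules of the grammar of a list of clauses. -/
inductive ProgRule (P : List (List (Hyp α R) × R)) (K : ℕ) : Rule α (ProgNonterminal R K) → Prop
  | nil : ProgRule P K (.word none [])
  | cons (a : α) : ProgRule P K (.conj none [⟨[a], none, []⟩] (List.cons_ne_nil _ _))
  | word (A : ProgNonterminal R K) (z : List α) (hz : z.length < 4 * K) (h : ProgSem P K A z) :
      ProgRule P K (.word A z)
  | clause (c : List (Hyp α R) × R) (hc : c ∈ P) (p q m : List α) (hp : p.length = 2 * K)
      (hq : q.length = 2 * K) (k l : Fin (K + 1))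
      (h : ∀ δ ∈ c.1, δ.Lit (p ++ m ++ q) k.val ((p ++ m ++ q).length - 1 - l.val)) :
      ProgRule P K (clauseRule c p q k l)

theorem finite_progRule [Finite α] [Finite R] (P : List (List (Hyp α R) × R)) (K : ℕ) :
    {r | ProgRule P K r}.Finite := by
  have hlen : {p : List α | p.length = 2 * K}.Finite := List.finite_length_eq α _
  have f1 : (Set.range fun a : α => (Rule.conj none [⟨[a], none, []⟩]
      (List.cons_ne_nil _ _) : Rule α (ProgNonterminal R K))).Finite := Set.finite_range _
  have f2 : ((fun x : ProgNonterminal R K × List α => Rule.word x.1 x.2) ''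
      (Set.univ ×ˢ {z : List α | z.length < 4 * K})).Finite :=
    (Set.finite_univ.prod (List.finite_length_lt α _)).image _
  -- The middle word `m` witnessing a clause rule does not occur in the rule, so it does not affect
  -- finiteness.
  have f3 : ((fun x : (List (Hyp α R) × R) × (List α × List α) × (Fin (K + 1) × Fin (K + 1)) =>
      clauseRule x.1 x.2.1.1 x.2.1.2 x.2.2.1 x.2.2.2) ''
      ({c | c ∈ P} ×ˢ (({p : List α | p.length = 2 * K} ×ˢ {p : List α | p.length = 2 * K}) ×ˢ
        Set.univ))).Finite :=
    ((List.finite_toSet P).prod ((hlen.prod hlen).prod Set.finite_univ)).image _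
  refine (((Set.finite_singleton (Rule.word none [])).union f1).union (f2.union f3)).subset ?_
  intro r hr
  cases hr with
  | nil => exact Or.inl (Or.inl rfl)
  | cons a => exact Or.inl (Or.inr ⟨a, rfl⟩)
  | word A z hz h => exact Or.inr (Or.inl ⟨(A, z), ⟨Set.mem_univ _, hz⟩, rfl⟩)
  | clause c hc p q m hp hq k l h =>
    exact Or.inr (Or.inr ⟨(c, (p, q), (k, l)), ⟨hc, ⟨hp, hq⟩, Set.mem_univ _⟩, rfl⟩)

/-- The grammar of a list of clauses. -/
abbrev progGrammar [Finite α] [Finite R] (P : List (List (Hyp α R) × R)) (K : ℕ) (S : R) :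
    LinConjGrammar α where
  N := ProgNonterminal R K
  finite_N := inferInstance
  P := {r | ProgRule P K r}
  finite_P := finite_progRule P K
  S := some (S, 0, 0)

theorem take_append_middle_append_drop (z : List α) (a b : ℕ) (h : a + b ≤ z.length) :
    ∃ m, z = z.take a ++ m ++ z.drop (z.length - b) := by
  refine ⟨(z.drop a).take (z.length - b - a), ?_⟩
  have : z.drop (z.length - b) = (z.drop a).drop (z.length - b - a) := by
    rw [List.drop_drop]; congr 1; omega
  rw [this, List.append_assoc, List.take_append_drop, List.take_append_drop]

/-! ### Correctness of the grammar of a list of clauses -/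

variable [Finite α] [Finite R]

/-- A clause rule was licensed by some middle `m`, whereas the generated word has another middle
`m'`; `Hyp.lit_middle` transfers the literals. Each further conjunct yields a derivation in a
trimmed word, which `Der.append` carries to the full word. -/
theorem progSem_of_gen (hP : ∀ c ∈ P, ∀ δ ∈ c.1, δ.size < K) (hK : 0 < K) {S₀ : R}
    {A : (progGrammar P K S₀).N} {z : List α} (h : (progGrammar P K S₀).Gen A z) :
    ProgSem P K A z := by
  induction h with
  | word A z h =>
    cases h with
    | nil => trivial
    | word _ _ _ h => exact h
  | conj A body hb h z zc hw hz ih =>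
    rcases h with _ | _ | _ | ⟨c, hc, p, q, m, hp, hq, k, l, hlit⟩
    · trivial
    · have hk := k.isLt
      have hl := l.isLt
      -- The conjunct `p none q` is what forces the prefix and suffix of `z`.
      obtain ⟨m', rfl⟩ : ∃ m', z = p ++ m' ++ q := ⟨_, hw _ List.mem_cons_self⟩
      have hlen : (p ++ m' ++ q).length = 4 * K + m'.length := by
        simp only [List.length_append]; omega
      refine ⟨by omega, .intro c hc _ _ (by omega) (by omega) ?_ ?_⟩
      · exact fun δ hδ =>
          Hyp.lit_middle (hP c hc δ hδ) hp hq m m' (by omega) (by omega) (hlit δ hδ)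
      · intro T a b hT
        have hab : a + b < K := hP c hc _ hT
        have hmem := List.mem_cons_of_mem (⟨p, none, q⟩ : Conjunct α (ProgNonterminal R K))
          (List.mem_filterMap.2 ⟨_, hT, rfl⟩ :
            _ ∈ c.1.filterMap (hypConjunct p q k l))
        obtain ⟨h1, h2⟩ := ih _ hmem
        have hz := hw _ hmem
        simp only at h1 h2 hz
        generalize zc _ = z' at h1 h2 hz
        have e := congrArg List.length hz
        rw [hlen] at e
        simp only [List.length_append, List.length_take, List.length_drop, hp, hq] at e
        have := h2.append hP (p.take (k.val + a - K)) (q.drop (2 * K - (l.val + b - K))) ?_ ?_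
        · rw [← hz] at this
          convert this using 1
          · rw [hlen]; simp only [clamp, List.length_take]; omega
          · rw [hlen]; simp only [clamp, List.length_take]; omega
        -- Letters are trimmed on the left only when the context would exceed `K`, and then exactly
        -- `K` remain.
        · by_cases h0 : k.val + a ≤ K
          · left; rw [Nat.sub_eq_zero_of_le h0, List.take_zero]
          · right; omega
        · by_cases h0 : l.val + b ≤ K
          · left; apply List.drop_eq_nil_of_le; omega
          · right; omega

theorem gen_none (S₀ : R) (m : List α) : (progGrammar P K S₀).Gen none m := by
  induction m with
  | nil => exact .word _ _ .nil
  | cons a m ih =>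
    refine .conj_of_exists (G := progGrammar P K S₀) (ProgRule.cons a) fun c hc => ?_
    rw [List.mem_singleton] at hc
    subst hc
    exact ⟨m, by simp, ih⟩

/-- The derivation lives in the fixed word `w`, while the grammar passes to shorter and shorter
factors. The induction therefore ranges over all factors `z` of `w` that retain a context of `K`
letters on each side where something was cut off. -/
theorem gen_of_der (hP : ∀ c ∈ P, ∀ δ ∈ c.1, δ.size < K) (hK : 0 < K) (S₀ : R) {w : List α}
    {S : R} {i j : ℕ} (h : Der P w S i j) :
    ∀ (c z d : List α) (k l : Fin (K + 1)), w = c ++ z ++ d → i = c.length + k.val →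
      j + l.val + 1 = c.length + z.length → (c = [] ∨ k.val = K) → (d = [] ∨ l.val = K) →
      (progGrammar P K S₀).Gen (some (S, k, l)) z := by
  induction h with
  | intro r hr i j hij hj lit sub ih =>
    intro c z d k l hw hi hj' hc hd
    have hk := k.isLt
    have hl := l.isLt
    have hkl : k.val + l.val < z.length := by omega
    have hjz : j = c.length + (z.length - 1 - l.val) := by omega
    have hc' : c = [] ∨ K ≤ k.val := hc.imp_right fun h => h.ge
    have hd' : d = [] ∨ z.length - 1 - l.val + K < z.length := hd.imp_right fun _ => by omega
    -- Short words are listed as rules; longer ones have disjoint prefix and suffix of length `2 *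
    -- K`.
    by_cases hz : z.length < 4 * K
    · refine .word _ _ (.word _ _ hz ⟨hkl, ?_⟩)
      exact (Der.intro r hr i j hij hj lit sub).of_append hP hw _ _ hi hjz (by omega) hc' hd'
    · obtain ⟨m, hm⟩ := take_append_middle_append_drop z (2 * K) (2 * K) (by omega)
      have hlit : ∀ δ ∈ r.1, δ.Lit z k.val (z.length - 1 - l.val) := by
        intro δ hδ
        have := lit δ hδ
        rw [hw, hi, hjz] at this
        exact (Hyp.lit_append (hP r hr δ hδ) c z d (by omega) (by omega) hc' hd').1 this
      have hrule : ProgRule P K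
          (clauseRule r (z.take (2 * K)) (z.drop (z.length - 2 * K)) k l) := by
        refine .clause r hr _ _ m ?_ ?_ k l ?_
        · rw [List.length_take]; omega
        · rw [List.length_drop]; omega
        · rwa [← hm]
      refine .conj_of_exists (G := progGrammar P K S₀) hrule fun x hx => ?_
      rcases List.mem_cons.1 hx with rfl | hx
      · exact ⟨m, hm, gen_none S₀ m⟩
      · obtain ⟨δ, hδ, e⟩ := List.mem_filterMap.1 hx
        cases δ with
        | comp T a b =>
          have hab : a + b < K := hP r hr _ hδ
          obtain rfl := Option.some.inj e
          -- The contexts of the new interval in `z` have `k + a` and `l + b` letters; the excess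
          -- over `K` is cut off on each side.
          obtain ⟨z', hz'⟩ := take_append_middle_append_drop z (k.val + a - K) (l.val + b - K)
            (by omega)
          have e1 : (z.take (2 * K)).take (k.val + a - K) = z.take (k.val + a - K) := by
            rw [List.take_take]; congr 1; omega
          have e2 : (z.drop (z.length - 2 * K)).drop (2 * K - (l.val + b - K)) =
              z.drop (z.length - (l.val + b - K)) := by
            rw [List.drop_drop]; congr 1; omega
          have hlen := congrArg List.length hz'
          simp only [List.length_append, List.length_take, List.length_drop] at hlen
          have hwl := congrArg List.length hw
          simp only [List.length_append] at hwl
          refine ⟨z', ?_, ?_⟩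
          · simp only [e1, e2]
            exact hz'
          · apply ih T a b hδ (c ++ z.take (k.val + a - K)) z'
              (z.drop (z.length - (l.val + b - K)) ++ d)
            · rw [hw]
              conv_lhs => rw [hz']
              simp only [List.append_assoc]
            · simp only [clamp, List.length_append, List.length_take]; omega
            · simp only [clamp, List.length_append, List.length_take]; omega
            · by_cases h0 : k.val + a ≤ K
              · refine hc.imp (fun h => ?_) fun h => ?_
                · rw [Nat.sub_eq_zero_of_le h0, List.take_zero, h, List.append_nil]
                · simp only; omega
              · right; simp only; omega
            · by_cases h0 : l.val + b ≤ K
              · refine hd.imp (fun h => ?_) fun h => ?_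
                · rw [Nat.sub_eq_zero_of_le h0, Nat.sub_zero, List.drop_length, h,
                    List.append_nil]
                · simp only; omega
              · right; simp only; omega
        | _ => simp [hypConjunct] at e

theorem gen_start_iff (hP : ∀ c ∈ P, ∀ δ ∈ c.1, δ.size < K) (hK : 0 < K) (S : R) (w : List α) :
    (progGrammar P K S).Gen (some (S, 0, 0)) w ↔ w ≠ [] ∧ Der P w S 0 (w.length - 1) := by
  constructor
  · intro h
    obtain ⟨h1, h2⟩ := progSem_of_gen hP hK h
    refine ⟨?_, h2⟩
    rintro rfl
    simp at h1
  · rintro ⟨h1, h2⟩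
    have := List.length_pos_iff.2 h1
    exact gen_of_der hP hK S h2 [] w [] 0 0 (by simp) (by simp) (by simp; omega)
      (Or.inl rfl) (Or.inl rfl)

end FormulaToGrammar

theorem linConj_of_inclESOHORN {α : Type u} [Finite α] {L : Set (List α)} (h : InclESOHORN L) :
    LinConj (sigmaPlus α \ L) := by
  obtain ⟨Φ, rfl⟩ := h
  have := Φ.finite_R
  obtain ⟨K, hK, hP⟩ := exists_size_lt (programOf Φ.clauses)
  refine ⟨progGrammar (programOf Φ.clauses) K none, ?_⟩
  ext w
  refine (gen_start_iff hP hK none w).trans ?_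
  have : ∀ hw : w ≠ [], Φ.Models w ↔ ¬ Der (programOf Φ.clauses) w none 0 (w.length - 1) :=
    fun hw => exists_model_iff_not_der Φ.clauses hw
  constructor
  · rintro ⟨h1, h2⟩
    exact ⟨h1, fun h => (this h1).1 h.2 h2⟩
  · rintro ⟨h1, h2⟩
    refine ⟨h1, ?_⟩
    by_contra h
    exact h2 ⟨h1, (this h1).2 h⟩

end InclHorn

theorem mainTheorem4 {α : Type*} [Finite α] (L : Set (List α)) (hL : L ⊆ InclHorn.sigmaPlus α) :
    InclHorn.InclESOHORN L ↔ InclHorn.LinConj (InclHorn.sigmaPlus α \ L) := by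
  exact ⟨InclHorn.linConj_of_inclESOHORN, InclHorn.inclESOHORN_of_linConj hL⟩
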